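/- Let $\mathcal P$ be a countable set of propositional variables. The formulas of positive probability logic ($PPL$) are given by the grammar $$\varphi ::= p \mid \neg p \mid \varphi\wedge\varphi \mid \varphi\vee\varphi \mid L_r\varphi \mid M_r\varphi \qquad (p\in\mathcal P,\ r\in\mathbb Q\cap[0,1]).$$ A finitely additive probability model is a tuple $\mathfrak M=(\Omega,\mathcal A,T,v)$, where $\mathcal A$ is an algebra of subsets of a non-empty set $\Omega$, $v:\mathcal P\to\mathcal A$, and $T:\Omega\times\mathcal A\to[0,1]$ is such that for each $w\in\Omega$ the function $T(w)=T(w,\cdot)$ is a finitely additive probability measure on $\mathcal A$, and $\{w\in\Omega \mid T(w)(E)\ge r\}\in\mathcal A$ for all $E\in\mathcal A$ and $r\in\mathbb Q\cap[0,1]$. Satisfaction $\mathfrak M,w\models\varphi$ is defined by $\mathfrak M,w\models p$ iff $w\in v(p)$, as usual for $\neg p$, $\wedge$, $\vee$, and, with $[\![\varphi]\!]=\{x\in\Omega\mid \mathfrak M,x\models\varphi\}$ (which always belongs to $\mathcal A$), $$\mathfrak M,w\models L_r\varphi \iff T(w)([\![\varphi]\!])\ge r,\qquad \mathfrak M,w\models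 M_r\varphi \iff T(w)([\![\varphi]\!])\le r .$$ A set $\Gamma$ of $PPL$-formulas is satisfiable if there are a finitely additive probability model $\mathfrak M$ and a point $w\in\Omega$ with $\mathfrak M,w\models\varphi$ for all $\varphi\in\Gamma$; it is finitely satisfiable if every finite subset of $\Gamma$ is satisfiable. **Theorem ($PPL$-Compactness).** Let $\Gamma$ be a set of $PPL$-formulas. Then $\Gamma$ is satisfiable if and only if it is finitely satisfiable. In particular, every finitely satisfiable positive theory has a finitely additive probability model. -/

import Mathlib

universe u v

namespace ProbLogic

/-- Formulas of positive probability logic over the propositional variables `P`: literals `p`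
and `¬p`, conjunction, disjunction, and for every `r ∈ ℚ ∩ [0,1]` the operators
`L r` ("probability at least `r`") and `M r` ("probability at most `r`"), freely nested. -/
inductive PosFormula (P : Type u) : Type u where
  | var : P → PosFormula P
  | negVar : P → PosFormula P
  | and : PosFormula P → PosFormula P → PosFormula P
  | or : PosFormula P → PosFormula P → PosFormula P
  | L : Set.Icc (0 : ℚ) 1 → PosFormula P → PosFormula P
  | M : Set.Icc (0 : ℚ) 1 → PosFormula P → PosFormula P

/-- A finitely additive probability model `(Ω, 𝒜, T, v)`. The function `T w` is a finitely
additive probability measure on `𝒜`; as usual in Lean it is given on all sets, but it is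
constrained and used only on members of `𝒜` (see `FinAddModel.truthSet_mem`). -/
structure FinAddModel (P : Type u) where
  /-- the set of states -/
  Ω : Type v
  nonempty : Nonempty Ω
  /-- the algebra of events -/
  𝒜 : Set (Set Ω)
  isSetAlgebra : MeasureTheory.IsSetAlgebra 𝒜
  /-- the type function -/
  T : Ω → Set Ω → ℝ
  T_mem_Icc : ∀ w, ∀ E ∈ 𝒜, T w E ∈ Set.Icc (0 : ℝ) 1
  T_univ : ∀ w, T w Set.univ = 1
  T_union : ∀ w, ∀ E ∈ 𝒜, ∀ F ∈ 𝒜, Disjoint E F → T w (E ∪ F) = T w E + T w F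
  /-- measurability of the type function -/
  T_measurable : ∀ E ∈ 𝒜, ∀ r : Set.Icc (0 : ℚ) 1, {w | T w E ≥ ((r : ℚ) : ℝ)} ∈ 𝒜
  /-- the valuation of the propositional variables -/
  val : P → Set Ω
  val_mem : ∀ p, val p ∈ 𝒜

namespace FinAddModel

variable {P : Type u}

/-- The satisfaction relation `𝔐, w ⊨ φ`. -/
def Sat (𝔐 : FinAddModel.{u, v} P) : 𝔐.Ω → PosFormula P → Prop
  | w, .var p => w ∈ 𝔐.val p
  | w, .negVar p => w ∉ 𝔐.val p
  | w, .and φ ψ => 𝔐.Sat w φ ∧ 𝔐.Sat w ψ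
  | w, .or φ ψ => 𝔐.Sat w φ ∨ 𝔐.Sat w ψ
  | w, .L r φ => 𝔐.T w {x | 𝔐.Sat x φ} ≥ ((r : ℚ) : ℝ)
  | w, .M r φ => 𝔐.T w {x | 𝔐.Sat x φ} ≤ ((r : ℚ) : ℝ)

/-- Every formula defines an event, so `Sat` never evaluates `T w` outside the algebra. -/
theorem truthSet_mem (𝔐 : FinAddModel.{u, v} P) (φ : PosFormula P) :
    {w | 𝔐.Sat w φ} ∈ 𝔐.𝒜 := by
  have hA := 𝔐.isSetAlgebra
  induction φ with
  | var p => exact 𝔐.val_mem p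
  | negVar p => exact hA.compl_mem (𝔐.val_mem p)
  | and φ ψ hφ hψ => exact hA.inter_mem hφ hψ
  | or φ ψ hφ hψ => exact hA.union_mem hφ hψ
  | L r φ hφ => exact 𝔐.T_measurable _ hφ r
  | M r φ hφ =>
    have h := 𝔐.T_measurable _ (hA.compl_mem hφ)
      ⟨1 - r, by have := r.2.2; linarith, by have := r.2.1; linarith⟩
    convert h using 1
    ext w
    have h1 := 𝔐.T_union w _ hφ _ (hA.compl_mem hφ) disjoint_compl_right
    rw [Set.union_compl_self, 𝔐.T_univ] at h1
    simp only [Sat, Set.mem_ofPred_eq, Rat.cast_sub, Rat.cast_one, ge_iff_le]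
    constructor <;> intro h2 <;> linarith

end FinAddModel

/-- A theory is satisfiable if all its formulas hold at one point of one finitely additive
probability model. -/
def Satisfiable {P : Type u} (Γ : Set (PosFormula P)) : Prop :=
  ∃ (𝔐 : FinAddModel.{u, v} P) (w : 𝔐.Ω), ∀ φ ∈ Γ, 𝔐.Sat w φ

/-- A theory is finitely satisfiable if each of its finite subsets is satisfiable. -/
def FinitelySatisfiable {P : Type u} (Γ : Set (PosFormula P)) : Prop :=
  ∀ Δ : Set (PosFormula P), Δ ⊆ Γ → Δ.Finite → Satisfiable.{u, v} Δ

end ProbLogic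

namespace ProbLogic

open Filter Topology

/-! Take pointed models of growing finite parts of Γ, form their disjoint union, and add one point
whose measure is the ultrafilter limit of the measures at the chosen points. Finite additivity
survives such limits. Old points keep their truths (`sat_limitModel_some`), and the new point
inherits every formula true at almost all chosen points (`sat_limitModel_none`), because `L` and `M`
impose closed conditions. -/

/-- Lets Γ be indexed by ℕ, which lifts to `Type v`, so the union of the models stays in that
universe. -/
theorem PosFormula.countable (P : Type u) [Countable P] : Countable (PosFormula P) := by
  obtain ⟨f, hf⟩ := exists_injective_nat P
  obtain ⟨g, hg⟩ := exists_injective_nat (Set.Icc (0 : ℚ) 1)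
  let code : PosFormula P → ℕ := PosFormula.rec (motive := fun _ => ℕ)
    (fun p => Nat.pair 0 (f p)) (fun p => Nat.pair 1 (f p))
    (fun _ _ a b => Nat.pair 2 (Nat.pair a b)) (fun _ _ a b => Nat.pair 3 (Nat.pair a b))
    (fun r _ a => Nat.pair 4 (Nat.pair (g r) a)) (fun r _ a => Nat.pair 5 (Nat.pair (g r) a))
  have hcode : Function.Injective code := by
    intro φ
    induction φ with
    | var p =>
      intro ψ h
      cases ψ <;> simp [code, Nat.pair_eq_pair] at h
      rw [hf h]
    | negVar p =>
      intro ψ h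
      cases ψ <;> simp [code, Nat.pair_eq_pair] at h
      rw [hf h]
    | and φ₁ φ₂ h₁ h₂ =>
      intro ψ h
      cases ψ <;> simp [code, Nat.pair_eq_pair] at h
      rw [h₁ h.1, h₂ h.2]
    | or φ₁ φ₂ h₁ h₂ =>
      intro ψ h
      cases ψ <;> simp [code, Nat.pair_eq_pair] at h
      rw [h₁ h.1, h₂ h.2]
    | L r φ h₁ =>
      intro ψ h
      cases ψ <;> simp [code, Nat.pair_eq_pair] at h
      rw [hg h.1, h₁ h.2]
    | M r φ h₁ =>
      intro ψ h
      cases ψ <;> simp [code, Nat.pair_eq_pair] at h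
      rw [hg h.1, h₁ h.2]
  exact hcode.countable

/-- Compactness of the interval makes `limUnder` a genuine limit, not a default value. -/
theorem tendsto_limUnder_ultrafilter {ι : Type*} (U : Ultrafilter ι) {f : ι → ℝ} {a b : ℝ}
    (hf : ∀ i, f i ∈ Set.Icc a b) : Tendsto f U (𝓝 (limUnder (U : Filter ι) f)) := by
  obtain ⟨x, -, hx⟩ := (isCompact_Icc (a := a) (b := b)).ultrafilter_le_nhds' (U.map f)
    (Ultrafilter.mem_map.2 (Filter.univ_mem' hf))
  exact tendsto_nhds_limUnder ⟨x, hx⟩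

namespace FinAddModel

variable {P : Type u} {ι : Type v}

/-- The part of a subset of the disjoint union with one extra point lying in the summand `i`. -/
def slice {Ω : ι → Type v} (E : Set (Option (Σ i, Ω i))) (i : ι) : Set (Ω i) :=
  {x | some ⟨i, x⟩ ∈ E}

/-- The type function of `limitModel`: at the extra point `none` it is the ultrafilter limit of
the measures at the chosen points. -/
noncomputable def limitT (U : Ultrafilter ι) (𝔐 : ι → FinAddModel.{u, v} P)
    (w : ∀ i, (𝔐 i).Ω) : Option (Σ i, (𝔐 i).Ω) → Set (Option (Σ i, (𝔐 i).Ω)) → ℝ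
  | some x, E => (𝔐 x.1).T x.2 (slice E x.1)
  | none, E => limUnder (U : Filter ι) fun i => (𝔐 i).T (w i) (slice E i)

/-- The algebra of `limitModel`: the sets all of whose slices are events. -/
def limitAlgebra (𝔐 : ι → FinAddModel.{u, v} P) : Set (Set (Option (Σ i, (𝔐 i).Ω))) :=
  {E | ∀ i, slice E i ∈ (𝔐 i).𝒜}

theorem tendsto_limitT (U : Ultrafilter ι) (𝔐 : ι → FinAddModel.{u, v} P)
    (w : ∀ i, (𝔐 i).Ω) {E : Set (Option (Σ i, (𝔐 i).Ω))} (hE : E ∈ limitAlgebra 𝔐) :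
    Tendsto (fun i => (𝔐 i).T (w i) (slice E i)) U (𝓝 (limitT U 𝔐 w none E)) :=
  tendsto_limUnder_ultrafilter U fun i => (𝔐 i).T_mem_Icc (w i) _ (hE i)

/-- The disjoint union of the models `𝔐 i` together with one extra point `none`, which is the
limit along `U` of the points `w i`. -/
noncomputable def limitModel (U : Ultrafilter ι) (𝔐 : ι → FinAddModel.{u, v} P)
    (w : ∀ i, (𝔐 i).Ω) : FinAddModel.{u, v} P where
  Ω := Option (Σ i, (𝔐 i).Ω)
  nonempty := ⟨none⟩
  𝒜 := limitAlgebra 𝔐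
  isSetAlgebra :=
    { empty_mem := fun i => (𝔐 i).isSetAlgebra.empty_mem
      compl_mem := fun _ h i => (𝔐 i).isSetAlgebra.compl_mem (h i)
      union_mem := fun _ _ h h' i => (𝔐 i).isSetAlgebra.union_mem (h i) (h' i) }
  T := limitT U 𝔐 w
  T_mem_Icc := by
    rintro (_ | x) E hE
    · exact isClosed_Icc.mem_of_tendsto (tendsto_limitT U 𝔐 w hE)
        (Eventually.of_forall fun i => (𝔐 i).T_mem_Icc (w i) _ (hE i))
    · exact (𝔐 x.1).T_mem_Icc x.2 _ (hE x.1)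
  T_univ := by
    rintro (_ | x)
    · have h : (fun i => (𝔐 i).T (w i) (slice (Ω := fun i => (𝔐 i).Ω) Set.univ i)) =
          fun _ => 1 :=
        funext fun i => (𝔐 i).T_univ (w i)
      exact (congrArg (limUnder (U : Filter ι)) h).trans tendsto_const_nhds.limUnder_eq
    · exact (𝔐 x.1).T_univ x.2
  T_union := by
    have hadd : ∀ E ∈ limitAlgebra 𝔐, ∀ F ∈ limitAlgebra 𝔐, Disjoint E F → ∀ i x,
        (𝔐 i).T x (slice (E ∪ F) i) = (𝔐 i).T x (slice E i) + (𝔐 i).T x (slice F i) :=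
      fun E hE F hF hEF i x => (𝔐 i).T_union x _ (hE i) (slice F i) (hF i)
        (hEF.preimage fun y : (𝔐 i).Ω => some (⟨i, y⟩ : Σ i, (𝔐 i).Ω))
    rintro (_ | x) E hE F hF hEF
    · refine Tendsto.limUnder_eq ?_
      simp_rw [hadd E hE F hF hEF]
      exact (tendsto_limitT U 𝔐 w hE).add (tendsto_limitT U 𝔐 w hF)
    · exact hadd E hE F hF hEF x.1 x.2
  -- Events are tested on slices only, so the limit measure at `none` imposes no condition here.
  T_measurable := fun _ hE r i => (𝔐 i).T_measurable _ (hE i) r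
  val := fun p => {x | match x with
    | none => ∀ᶠ i in U, w i ∈ (𝔐 i).val p
    | some x => x.2 ∈ (𝔐 x.1).val p}
  val_mem := fun p i => (𝔐 i).val_mem p

variable (U : Ultrafilter ι) (𝔐 : ι → FinAddModel.{u, v} P) (w : ∀ i, (𝔐 i).Ω)

/-- The measure at a point of summand `i` sees only the slice `i`, so `none` has no influence. -/
theorem sat_limitModel_some (φ : PosFormula P) (i : ι) (x : (𝔐 i).Ω) :
    (limitModel U 𝔐 w).Sat (some ⟨i, x⟩) φ ↔ (𝔐 i).Sat x φ := by
  induction φ generalizing i x with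
  | var p => exact Iff.rfl
  | negVar p => exact Iff.rfl
  | and φ ψ hφ hψ => exact and_congr (hφ i x) (hψ i x)
  | or φ ψ hφ hψ => exact or_congr (hφ i x) (hψ i x)
  | L r φ hφ =>
    have h : slice {y | (limitModel U 𝔐 w).Sat y φ} i = {y | (𝔐 i).Sat y φ} :=
      Set.ext fun y => hφ i y
    exact iff_of_eq (congrArg (fun E => (𝔐 i).T x E ≥ ((r : ℚ) : ℝ)) h)
  | M r φ hφ =>
    have h : slice {y | (limitModel U 𝔐 w).Sat y φ} i = {y | (𝔐 i).Sat y φ} :=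
      Set.ext fun y => hφ i y
    exact iff_of_eq (congrArg (fun E => (𝔐 i).T x E ≤ ((r : ℚ) : ℝ)) h)

theorem tendsto_limitModel_truthSet (φ : PosFormula P) :
    Tendsto (fun i => (𝔐 i).T (w i) {y | (𝔐 i).Sat y φ}) U
      (𝓝 ((limitModel U 𝔐 w).T none {y | (limitModel U 𝔐 w).Sat y φ})) := by
  have h : ∀ i, slice {y | (limitModel U 𝔐 w).Sat y φ} i = {y | (𝔐 i).Sat y φ} :=
    fun i => Set.ext fun y => sat_limitModel_some U 𝔐 w φ i y
  simp_rw [← h]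
  exact tendsto_limitT U 𝔐 w ((limitModel U 𝔐 w).truthSet_mem φ)

/-- Only one direction holds in general: probabilities strictly below `r` can converge to `r`.
Positivity makes it suffice, negation occurring only on variables, where `U` decides. -/
theorem sat_limitModel_none {φ : PosFormula P} (h : ∀ᶠ i in U, (𝔐 i).Sat (w i) φ) :
    (limitModel U 𝔐 w).Sat none φ := by
  induction φ with
  | var p => exact h
  | negVar p => exact Ultrafilter.eventually_not.1 h
  | and φ ψ hφ hψ => exact ⟨hφ (h.mono fun _ h => h.1), hψ (h.mono fun _ h => h.2)⟩
  | or φ ψ hφ hψ => exact (Ultrafilter.eventually_or.1 h).imp hφ hψ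
  | L r φ => exact ge_of_tendsto (tendsto_limitModel_truthSet U 𝔐 w φ) h
  | M r φ => exact le_of_tendsto (tendsto_limitModel_truthSet U 𝔐 w φ) h

end FinAddModel

end ProbLogic

theorem theorem2 {P : Type u} [Countable P] (Γ : Set (ProbLogic.PosFormula P)) :
    ProbLogic.Satisfiable.{u, v} Γ ↔ ProbLogic.FinitelySatisfiable.{u, v} Γ := by
  refine ⟨fun ⟨𝔐, w, h⟩ Δ hΔ _ => ⟨𝔐, w, fun φ hφ => h φ (hΔ hφ)⟩, fun hfin => ?_⟩
  -- Only a nonempty set is the range of a sequence.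
  rcases Γ.eq_empty_or_nonempty with rfl | hne
  · exact hfin ∅ le_rfl Set.finite_empty
  have := ProbLogic.PosFormula.countable P
  obtain ⟨f, rfl⟩ := Γ.to_countable.exists_eq_range hne
  choose 𝔐 w hw using fun n : ULift.{v} ℕ =>
    hfin (f '' Set.Iic n.down) (Set.image_subset_range _ _) ((Set.finite_Iic _).image _)
  -- Nonprincipality matters: `f k` is guaranteed at `w n` only for `n ≥ k`, a cofinite set of
  -- indices.
  let U : Ultrafilter (ULift.{v} ℕ) := (Filter.hyperfilter ℕ).map ULift.up
  refine ⟨ProbLogic.FinAddModel.limitModel U 𝔐 w, none, ?_⟩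
  rintro _ ⟨k, rfl⟩
  refine ProbLogic.FinAddModel.sat_limitModel_none U 𝔐 w ?_
  have hk : ∀ᶠ n in (Filter.hyperfilter ℕ : Filter ℕ), k ≤ n :=
    Nat.hyperfilter_le_atTop (Filter.eventually_ge_atTop k)
  exact hk.mono fun n hn => hw ⟨n⟩ _ ⟨k, hn, rfl⟩
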